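/- Let $\mathcal{E}$ and $\mathcal{S}$ be elementary toposes and let $p : \mathcal{E} \to \mathcal{S}$ be a pre-cohesive geometric morphism: that is, $p_* : \mathcal{E} \to \mathcal{S}$ has a fully faithful right adjoint $p^!$ ($p$ is local), $p^* : \mathcal{S} \to \mathcal{E}$ is fully faithful with image closed under subobjects ($p$ is hyperconnected), and $p^*$ has a left adjoint $p_! : \mathcal{E} \to \mathcal{S}$ ($p$ is essential) which preserves finite products. Assume that $\mathcal{S}$ is Boolean. For a level $l_! \dashv l^* \dashv l_* : \mathcal{L} \to \mathcal{E}$ (with $l_!, l_*$ fully faithful) whose skeleta, i.e. the counits $\ell_X : l_!(l^* X) \to X$, are monic, an object $X$ of $\mathcal{E}$ is said to have $l$-skeletal boundaries if $\mathrm{id}_X \le u \vee (u \Rightarrow \ell_X)$ in the Heyting algebra of subobjects of $X$, for every subobject $u$ of $X$. Level $-\infty$ is the level whose domain $\mathcal{L}$ is the terminal category; its skeleton at $X$ is $0 \to X$. Then the fully faithful functor $p^* : \mathcal{S} \to \mathcal{E}$ coincides with the full subcategory of objects of $\mathcal{E}$ with $-\infty$-skeletal boundaries: an object of $\mathcal{E}$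 is isomorphic to $p^* A$ for some $A$ in $\mathcal{S}$ if and only if it has $-\infty$-skeletal boundaries. Moreover, an object $X$ of $\mathcal{E}$ has $-\infty$-skeletal boundaries if and only if the Heyting algebra of subobjects of $X$ is Boolean. -/

import Mathlib

open CategoryTheory CategoryTheory.Limits

universe v₁ v₂ u₁ u₂

/-! ### Elementary toposes -/

/-- An elementary topos: a category with finite limits, exponentials and a subobject classifier.
(Exponentials are expressed by saying that each functor `A ⨯ -` has a right adjoint.) -/
class ElementaryTopos (E : Type u₁) [Category.{v₁} E] : Prop
    extends HasFiniteLimits E, HasSubobjectClassifier E where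
  isLeftAdjoint_prod : ∀ A : E, (prod.functor.obj A).IsLeftAdjoint

namespace ElementaryTopos

variable {E : Type u₁} [Category.{v₁} E]

section Generalities

theorem le_iff_factors {X : E} {u v : Subobject X} :
    u ≤ v ↔ ∀ {Z : E} (f : Z ⟶ X), u.Factors f → v.Factors f := by
  refine ⟨fun h Z f => Subobject.factors_of_le f h, fun h => ?_⟩
  have hv := h u.arrow (Subobject.factors_self u)
  exact Subobject.le_of_comm (v.factorThru _ hv) (Subobject.factorThru_arrow _ _ hv)

theorem eq_top_iff_factors {X : E} {u : Subobject X} : u = ⊤ ↔ u.Factors (𝟙 X) := by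
  constructor
  · rintro rfl
    exact Subobject.top_factors _
  · intro h
    rw [eq_top_iff, le_iff_factors]
    intro Z f _
    simpa using Subobject.factors_of_factors_right f h

theorem equalizer_factors_iff [HasFiniteLimits E] {X Y Z : E} (a b : X ⟶ Y) (f : Z ⟶ X) :
    (Subobject.mk (equalizer.ι a b)).Factors f ↔ f ≫ a = f ≫ b :=
  equalizerSubobject_factors_iff a b f

theorem pullback_eq_top_iff [HasFiniteLimits E] {X Z : E} (f : Z ⟶ X) (u : Subobject X) :
    (Subobject.pullback f).obj u = ⊤ ↔ u.Factors f := by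
  rw [eq_top_iff_factors, Limits.pullback_factors_iff, Category.id_comp]

end Generalities

variable [ElementaryTopos E]

/-- Subobjects are classified by maps to a fixed object. -/
theorem exists_representableBy :
    ∃ (Ω : E) (e : ∀ X : E, (X ⟶ Ω) ≃ Subobject X), ∀ {X Y : E} (f : X ⟶ Y) (a : Y ⟶ Ω),
      e X (f ≫ a) = (Subobject.pullback f).obj (e Y a) := by
  obtain ⟨⟨c⟩⟩ := (inferInstance : HasSubobjectClassifier E)
  exact ⟨c.Ω, fun X => c.representableBy.homEquiv (X := X),
    fun f a => c.representableBy.homEquiv_comp f a⟩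

/-- The Heyting implication of two subobjects, by its generalized elements. -/
theorem exists_himp {X : E} (u v : Subobject X) :
    ∃ w : Subobject X, ∀ {Z : E} (f : Z ⟶ X),
      w.Factors f ↔ ∀ {Z' : E} (h : Z' ⟶ Z), u.Factors (h ≫ f) → v.Factors (h ≫ f) := by
  obtain ⟨Ω, e, he⟩ := exists_representableBy (E := E)
  refine ⟨Subobject.mk (equalizer.ι ((e X).symm (u ⊓ v)) ((e X).symm u)),
    fun {Z} f => ?_⟩
  rw [equalizer_factors_iff, ← (e Z).injective.eq_iff, he, he,
    Equiv.apply_symm_apply, Equiv.apply_symm_apply, Subobject.inf_pullback, inf_eq_left, le_iff_factors]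
  simp only [Limits.pullback_factors_iff]

/-- Universal quantification of a subobject along a product projection. -/
theorem exists_forall {A X : E} (S : Subobject (A ⨯ X)) :
    ∃ w : Subobject X, ∀ {Z : E} (f : Z ⟶ X),
      w.Factors f ↔ S.Factors (prod.map (𝟙 A) f) := by
  obtain ⟨Ω, e, he⟩ := exists_representableBy (E := E)
  have := isLeftAdjoint_prod A
  let adj := Adjunction.ofIsLeftAdjoint (prod.functor.obj A)
  let c : Subobject (A ⨯ X) → (X ⟶ _) := fun T => adj.homEquiv X Ω ((e (A ⨯ X)).symm T)
  have hc : ∀ (T : Subobject (A ⨯ X)) {Z : E} (f : Z ⟶ X), f ≫ c T =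
      adj.homEquiv Z Ω ((e (A ⨯ Z)).symm ((Subobject.pullback (prod.map (𝟙 A) f)).obj T)) := by
    intro T Z f
    have h1 : (e (A ⨯ Z)).symm ((Subobject.pullback (prod.map (𝟙 A) f)).obj T) =
        prod.map (𝟙 A) f ≫ (e (A ⨯ X)).symm T := by
      rw [Equiv.symm_apply_eq, he, Equiv.apply_symm_apply]
    refine Eq.trans ?_ (congrArg (adj.homEquiv Z Ω) h1.symm)
    exact (adj.homEquiv_naturality_left f ((e (A ⨯ X)).symm T)).symm
  refine ⟨Subobject.mk (equalizer.ι (c S) (c ⊤)), fun {Z} f => ?_⟩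
  rw [equalizer_factors_iff, hc, hc]
  refine ((adj.homEquiv Z Ω).injective.eq_iff.trans (e (A ⨯ Z)).symm.injective.eq_iff).trans ?_
  rw [Subobject.pullback_top, pullback_eq_top_iff]

/-- The union of two subobjects. -/
theorem exists_sup {X : E} (u v : Subobject X) : ∃ w : Subobject X, IsLUB {u, v} w := by
  obtain ⟨Ω, e, he⟩ := exists_representableBy (E := E)
  let t : Subobject (Ω ⨯ X) := e (Ω ⨯ X) prod.fst
  have ht : ∀ {Z : E} (a : Z ⟶ Ω) (x : Z ⟶ X) {Z' : E} (h : Z' ⟶ Z),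
      t.Factors (h ≫ prod.lift a x) ↔ (e Z a).Factors h := by
    intro Z a x Z' h
    rw [← pullback_eq_top_iff, ← pullback_eq_top_iff, Subobject.pullback_comp]
    have : (Subobject.pullback (prod.lift a x)).obj t = (e Z a) := by
      have := he (prod.lift a x) (prod.fst : Ω ⨯ X ⟶ Ω)
      rw [prod.lift_fst] at this
      exact this.symm
    rw [this]
  obtain ⟨p, hp⟩ := exists_himp ((Subobject.pullback (prod.snd : Ω ⨯ X ⟶ X)).obj u) t
  obtain ⟨q, hq⟩ := exists_himp ((Subobject.pullback (prod.snd : Ω ⨯ X ⟶ X)).obj v) t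
  obtain ⟨s, hs⟩ := exists_himp (p ⊓ q) t
  obtain ⟨w, hw⟩ := exists_forall s
  have key : ∀ (z : Subobject X), u ≤ z → v ≤ z → w ≤ z := by
    intro z hu hv
    rw [le_iff_factors]
    intro Z f hf
    have h1 := Subobject.factors_of_factors_right
      (prod.lift ((e Z).symm ((Subobject.pullback f).obj z)) (𝟙 Z)) ((hw f).1 hf)
    rw [prod.lift_map, Category.comp_id, Category.id_comp, hs] at h1
    have h2 := h1 (𝟙 Z)
    rw [ht, Equiv.apply_symm_apply, Subobject.inf_factors, Category.id_comp, hp, hq] at h2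
    have h3 := h2 ⟨fun {Z'} h => ?_, fun {Z'} h => ?_⟩
    · exact (by simpa using (Limits.pullback_factors_iff f z (𝟙 Z)).1 h3)
    · rw [ht, Equiv.apply_symm_apply, Limits.pullback_factors_iff, Limits.pullback_factors_iff]
      intro hh
      rw [Category.assoc, prod.lift_snd] at hh
      exact Subobject.factors_of_le _ hu hh
    · rw [ht, Equiv.apply_symm_apply, Limits.pullback_factors_iff, Limits.pullback_factors_iff]
      intro hh
      rw [Category.assoc, prod.lift_snd] at hh
      exact Subobject.factors_of_le _ hv hh
  refine ⟨w, ⟨?_, fun z hz => key z (hz (by simp)) (hz (by simp))⟩⟩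
  rintro y (rfl | rfl)
  · rw [le_iff_factors]
    intro Z f hf
    rw [hw, hs]
    intro Z' h hh
    rw [Subobject.inf_factors, hp] at hh
    simpa using hh.1 (𝟙 Z') (by
      rw [Limits.pullback_factors_iff]
      simpa using Subobject.factors_of_factors_right (h ≫ prod.snd) hf)
  · rw [le_iff_factors]
    intro Z f hf
    rw [hw, hs]
    intro Z' h hh
    rw [Subobject.inf_factors, hq] at hh
    simpa using hh.2 (𝟙 Z') (by
      rw [Limits.pullback_factors_iff]
      simpa using Subobject.factors_of_factors_right (h ≫ prod.snd) hf)

theorem exists_initial : ∃ I : E, Nonempty (IsInitial I) ∧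
    ∀ {X : E} (f : I ⟶ X), Mono f := by
  obtain ⟨Ω, e, he⟩ := exists_representableBy (E := E)
  obtain ⟨w, hw⟩ := exists_forall (e (Ω ⨯ (⊤_ E)) prod.fst)
  have triv : ∀ {Z : E} (_ : Z ⟶ (w : E)) (s : Subobject Z), s = ⊤ := by
    intro Z g s
    have h1 := Subobject.factors_of_factors_right
      (prod.lift ((e Z).symm s) g) ((hw w.arrow).1 (Subobject.factors_self w))
    rw [prod.lift_map, Category.comp_id, ← pullback_eq_top_iff] at h1
    have h2 := he (prod.lift ((e Z).symm s) (g ≫ w.arrow))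
      (prod.fst : Ω ⨯ (⊤_ E) ⟶ Ω)
    rw [prod.lift_fst, Equiv.apply_symm_apply] at h2
    exact h2.trans h1
  have uniq : ∀ {Z Y : E} (_ : Z ⟶ (w : E)) (a b : Z ⟶ Y), a = b := by
    intro Z Y g a b
    have := (eq_top_iff_factors.1 (triv g (Subobject.mk (equalizer.ι a b))))
    rw [equalizer_factors_iff] at this
    simpa using this
  have ex : ∀ X : E, Nonempty ((w : E) ⟶ X) := by
    intro X
    have : Mono (prod.fst : (w : E) ⨯ X ⟶ (w : E)) := ⟨fun a b _ => uniq (a ≫ prod.fst) a b⟩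
    obtain ⟨i, -⟩ := eq_top_iff_factors.1
      (triv (𝟙 _) (Subobject.mk (prod.fst : (w : E) ⨯ X ⟶ (w : E))))
    exact ⟨i ≫ prod.snd⟩
  refine ⟨w, ⟨IsInitial.ofUniqueHom (fun X => (ex X).some) fun X m => uniq (𝟙 _) _ _⟩, ?_⟩
  exact fun f => ⟨fun a b _ => uniq a a b⟩

instance hasInitial : HasInitial E := by
  obtain ⟨I, ⟨h⟩, -⟩ := exists_initial (E := E)
  exact h.hasInitial

instance initialMonoClass : InitialMonoClass E := by
  obtain ⟨I, ⟨h⟩, hm⟩ := exists_initial (E := E)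
  exact InitialMonoClass.of_isInitial h fun X => hm _

theorem exists_himp' {X : E} (u v : Subobject X) :
    ∃ w : Subobject X, ∀ z, z ≤ w ↔ z ⊓ u ≤ v := by
  obtain ⟨w, hw⟩ := exists_himp u v
  refine ⟨w, fun z => ⟨fun h => ?_, fun h => ?_⟩⟩
  · rw [le_iff_factors]
    intro Z f hf
    rw [Subobject.inf_factors] at hf
    simpa using (hw f).1 (Subobject.factors_of_le f h hf.1) (𝟙 Z) (by simpa using hf.2)
  · rw [le_iff_factors]
    intro Z f hf
    rw [hw]
    intro Z' k hk
    exact Subobject.factors_of_le _ h ((Subobject.inf_factors _).2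
      ⟨Subobject.factors_of_factors_right k hf, hk⟩)

/-- The Heyting algebra of subobjects of an object of a topos, for the usual order (and Mathlib's
`⊤`, `⊥`, `⊓`) on `Subobject X`. -/
noncomputable instance heytingAlgebraSubobject (X : E) : HeytingAlgebra (Subobject X) where
  __ := Subobject.semilatticeInf
  __ := Subobject.orderTop
  __ := Subobject.orderBot
  sup u v := (exists_sup u v).choose
  le_sup_left u v := (exists_sup u v).choose_spec.1 (by simp)
  le_sup_right u v := (exists_sup u v).choose_spec.1 (by simp)
  sup_le u v z hu hv := (exists_sup u v).choose_spec.2 (by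
    rintro y (rfl | rfl)
    exacts [hu, hv])
  himp u v := (exists_himp' u v).choose
  le_himp_iff z u v := (exists_himp' u v).choose_spec z
  compl u := (exists_himp' u ⊥).choose
  himp_bot _ := rfl

end ElementaryTopos

/-- An object of a topos is Boolean if its Heyting algebra of subobjects is Boolean, i.e. if every
subobject has a complement. -/
def IsBooleanObject {E : Type u₁} [Category.{v₁} E] [ElementaryTopos E] (X : E) : Prop :=
  ComplementedLattice (Subobject X)

/-- A topos is Boolean if all its subobject algebras are Boolean. -/
def IsBooleanTopos (E : Type u₁) [Category.{v₁} E] [ElementaryTopos E] : Prop :=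
  ∀ X : E, IsBooleanObject X

/-! ### Levels and skeletal boundaries -/

/-- A level of `E`: a string of adjoints `l_! ⊣ l^* ⊣ l_* : L ⥤ E` with `l_!`, `l_*` fully
faithful. -/
structure Level (L : Type u₂) [Category.{v₂} L] (E : Type u₁) [Category.{v₁} E] where
  /-- the skeletal inclusion `l_!` -/
  lowerShriek : L ⥤ E
  /-- the restriction `l^*` -/
  upperStar : E ⥤ L
  /-- the direct image `l_*` -/
  lowerStar : L ⥤ E
  /-- `l_! ⊣ l^*` -/
  adjShriek : lowerShriek ⊣ upperStar
  /-- `l^* ⊣ l_*` -/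
  adjStar : upperStar ⊣ lowerStar
  full_lowerShriek : lowerShriek.Full
  faithful_lowerShriek : lowerShriek.Faithful
  full_lowerStar : lowerStar.Full
  faithful_lowerStar : lowerStar.Faithful

namespace Level

variable {L : Type u₂} [Category.{v₂} L] {E : Type u₁} [Category.{v₁} E]

/-- The `l`-skeleton `l_! (l^* X) ⟶ X` of `X`. -/
def skeleton (l : Level L E) (X : E) : l.lowerShriek.obj (l.upperStar.obj X) ⟶ X :=
  l.adjShriek.counit.app X

/-- The level `l` has monic skeleta. -/
class MonicSkeleta (l : Level L E) : Prop where
  mono_skeleton : ∀ X : E, Mono (l.skeleton X)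

attribute [instance] MonicSkeleta.mono_skeleton

variable [ElementaryTopos E]

/-- The subobject `u` of `X` has `l`-skeletal boundary: `id_X ≤ u ∨ (u ⇒ ℓ_X)` in the Heyting
algebra of subobjects of `X`, where `ℓ_X` is the skeleton of `X`. -/
def HasSkeletalBoundary (l : Level L E) [l.MonicSkeleta] {X : E} (u : Subobject X) : Prop :=
  Subobject.mk (𝟙 X) ≤ u ⊔ (u ⇨ Subobject.mk (l.skeleton X))

/-- The (full subcategory of) objects `X` with `l`-skeletal boundaries: every subobject of `X` has
`l`-skeletal boundary. -/
def skeletalBoundaries (l : Level L E) [l.MonicSkeleta] : ObjectProperty E :=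
  fun X => ∀ u : Subobject X, l.HasSkeletalBoundary u

variable (E)

/-- The level `-∞` of a topos: the degenerate level, whose domain is the terminal category. -/
noncomputable def minusInfty : Level (Discrete PUnit.{1}) E where
  lowerShriek := Functor.fromPUnit (⊥_ E)
  upperStar := Functor.star E
  lowerStar := Functor.fromPUnit (⊤_ E)
  adjShriek := Adjunction.mkOfHomEquiv
    { homEquiv := fun _ _ =>
        { toFun := fun _ => Discrete.eqToHom (Subsingleton.elim _ _)
          invFun := fun _ => initial.to _
          left_inv := fun _ => initial.hom_ext _ _
          right_inv := fun _ => Subsingleton.elim _ _ }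
      homEquiv_naturality_left_symm := fun _ _ => initial.hom_ext _ _
      homEquiv_naturality_right := fun _ _ => Subsingleton.elim _ _ }
  adjStar := Adjunction.mkOfHomEquiv
    { homEquiv := fun _ _ =>
        { toFun := fun _ => terminal.from _
          invFun := fun _ => Discrete.eqToHom (Subsingleton.elim _ _)
          left_inv := fun _ => Subsingleton.elim _ _
          right_inv := fun _ => terminal.hom_ext _ _ }
      homEquiv_naturality_left_symm := fun _ _ => Subsingleton.elim _ _
      homEquiv_naturality_right := fun _ _ => terminal.hom_ext _ _ }
  full_lowerShriek := ⟨fun {a b} _ =>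
    ⟨eqToHom (Subsingleton.elim a b), initial.hom_ext _ _⟩⟩
  faithful_lowerShriek := ⟨fun _ => Subsingleton.elim _ _⟩
  full_lowerStar := ⟨fun {a b} _ =>
    ⟨eqToHom (Subsingleton.elim a b), terminal.hom_ext _ _⟩⟩
  faithful_lowerStar := ⟨fun _ => Subsingleton.elim _ _⟩

instance monicSkeleta_minusInfty : (minusInfty E).MonicSkeleta where
  mono_skeleton _ := initialIsInitial.mono_from _

end Level

/-! ### Geometric morphisms -/

/-- A geometric morphism `p : E ⟶ S`: an adjunction `p^* ⊣ p_*` with `p^* : S ⥤ E` preserving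
finite limits. -/
structure GeomMorphism (E : Type u₁) [Category.{v₁} E] (S : Type u₂) [Category.{v₂} S] where
  /-- the inverse image `p^*` -/
  inverseImage : S ⥤ E
  /-- the direct image `p_*` -/
  directImage : E ⥤ S
  /-- `p^* ⊣ p_*` -/
  adj : inverseImage ⊣ directImage
  preservesFiniteLimits_inverseImage : PreservesFiniteLimits inverseImage

namespace GeomMorphism

variable {E : Type u₁} [Category.{v₁} E] {S : Type u₂} [Category.{v₂} S]

/-- `p` is local: `p_*` has a fully faithful right adjoint `p^!`. -/
def IsLocal (p : GeomMorphism E S) : Prop :=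
  ∃ upperShriek : S ⥤ E,
    Nonempty (p.directImage ⊣ upperShriek) ∧ upperShriek.Full ∧ upperShriek.Faithful

/-- `p` is hyperconnected: `p^*` is fully faithful and its (replete) image is closed under
subobjects. (Closure under quotients is then automatic.) -/
structure IsHyperconnected (p : GeomMorphism E S) : Prop where
  full : p.inverseImage.Full
  faithful : p.inverseImage.Faithful
  closedUnderSubobjects : p.inverseImage.essImage.IsClosedUnderSubobjects

/-- `p` is pre-cohesive: it is local, hyperconnected, essential (`p^*` has a left adjoint `p_!`) and
`p_!` preserves finite products. -/
structure IsPreCohesive (p : GeomMorphism E S) : Prop where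
  isLocal : p.IsLocal
  isHyperconnected : p.IsHyperconnected
  essential : ∃ lowerShriek : E ⥤ S,
    Nonempty (lowerShriek ⊣ p.inverseImage) ∧ PreservesFiniteProducts lowerShriek

end GeomMorphism

/-! The skeleton at level `-∞` is the bottom subobject, so the boundary condition on `u` becomes
excluded middle, `u ⊔ uᶜ = ⊤`: the objects in question are the Boolean ones.

Each `p^* A` is Boolean because hyperconnectedness identifies its subobjects with those of `A`
(`exists_subobject_orderIso`), and `S` is Boolean.

Conversely, the counit `p^* p_* X ⟶ X` is monic (`mono_counit`), so for Boolean `X` it has a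
complement `w`. Naturality of the counit sends `p^* p_* w` into both `w` and the counit subobject,
hence into `0`, so `p_* w` is empty. Since `p` is local, `w` is then empty too
(`exists_hom_initial_of_directImage`), and the counit is an isomorphism. -/

namespace ElementaryTopos

variable {E : Type u₁} [Category.{v₁} E] [ElementaryTopos E]

/-- The initial object of a topos is strict: a morphism out of an object `W` that maps to the
initial object factors through the initial object. -/
theorem eq_comp_initial_to {W X : E} (f : W ⟶ ⊥_ E) (g : W ⟶ X) : g = f ≫ initial.to X := by
  have := isLeftAdjoint_prod W
  -- The left adjoint `W ⨯ -` preserves the initial object, so any two maps out of `W ⨯ ⊥_ E` agree.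
  have h : IsInitial (W ⨯ (⊥_ E)) :=
    IsInitial.isInitialObj (prod.functor.obj W) _ initialIsInitial
  have key : prod.lift (𝟙 W) f ≫ prod.fst ≫ g = prod.lift (𝟙 W) f ≫ prod.snd ≫ initial.to X :=
    congrArg (prod.lift (𝟙 W) f ≫ ·) (h.hom_ext _ _)
  rwa [prod.lift_fst_assoc, prod.lift_snd_assoc, Category.id_comp] at key

theorem subobject_eq_bot {X : E} (u : Subobject X) (f : (u : E) ⟶ ⊥_ E) : u = ⊥ := by
  rw [eq_bot_iff, Subobject.bot_eq_initial_to]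
  exact Subobject.le_mk_of_comm f (eq_comp_initial_to f u.arrow).symm

end ElementaryTopos

open ElementaryTopos

/-- An object has `-∞`-skeletal boundaries exactly when its subobject algebra is Boolean. -/
theorem Level.skeletalBoundaries_minusInfty_iff {E : Type u₁} [Category.{v₁} E]
    [ElementaryTopos E] (X : E) :
    (Level.minusInfty E).skeletalBoundaries X ↔ IsBooleanObject X := by
  have hbot : Subobject.mk ((Level.minusInfty E).skeleton X) = ⊥ := by
    rw [Subobject.bot_eq_initial_to]
    congr 1
  have h (u : Subobject X) :
      (Level.minusInfty E).HasSkeletalBoundary u ↔ u ⊔ uᶜ = ⊤ := by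
    rw [Level.HasSkeletalBoundary, hbot, himp_bot, ← Subobject.top_eq_id, top_le_iff]
  constructor
  · intro hX
    exact ⟨fun u => ⟨uᶜ, disjoint_compl_right, codisjoint_iff.2 ((h u).1 (hX u))⟩⟩
  · rintro ⟨hX⟩ u
    obtain ⟨v, hv⟩ := hX u
    -- In a Heyting algebra a complement, if any, is the pseudocomplement.
    rw [h, hv.compl_eq]
    exact hv.sup_eq_top

theorem IsBooleanObject.of_orderIso {E : Type u₁} [Category.{v₁} E] [ElementaryTopos E]
    {S : Type u₂} [Category.{v₂} S] [ElementaryTopos S] {A : S} {X : E}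
    (e : Subobject A ≃o Subobject X) (hA : IsBooleanObject A) : IsBooleanObject X := by
  have : ComplementedLattice (Subobject A) := hA
  exact e.complementedLattice

/-! ### Hyperconnected morphisms: subobjects and the counit -/

namespace GeomMorphism

variable {E : Type u₁} [Category.{v₁} E] {S : Type u₂} [Category.{v₂} S]

/-- The inverse image of a hyperconnected geometric morphism identifies subobjects of `A` with
subobjects of any object isomorphic to `p^* A`. -/
theorem IsHyperconnected.exists_subobject_orderIso {p : GeomMorphism E S}
    (hp : p.IsHyperconnected) {A : S} {X : E} (i : p.inverseImage.obj A ≅ X) :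
    Nonempty (Subobject A ≃o Subobject X) := by
  have := hp.full
  have := hp.faithful
  have := hp.closedUnderSubobjects
  have := p.preservesFiniteLimits_inverseImage
  have hle (u v : Subobject A) :
      Subobject.mk (p.inverseImage.map u.arrow ≫ i.hom) ≤
        Subobject.mk (p.inverseImage.map v.arrow ≫ i.hom) ↔ u ≤ v := by
    constructor
    · intro h
      refine Subobject.le_of_comm (p.inverseImage.preimage (Subobject.ofMkLEMk _ _ h))
        (p.inverseImage.map_injective ?_)
      have h' := Subobject.ofMkLEMk_comp h
      rw [← Category.assoc, cancel_mono i.hom] at h'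
      simpa using h'
    · intro h
      refine Subobject.mk_le_mk_of_comm (p.inverseImage.map (Subobject.ofLE u v h)) ?_
      rw [← Category.assoc, ← Functor.map_comp, Subobject.ofLE_arrow]
  refine ⟨RelIso.ofSurjective (OrderEmbedding.ofMapLEIff _ hle) fun w => ?_⟩
  -- Closure under subobjects descends the domain of `w`, fullness descends its inclusion, and
  -- faithfulness reflects monicity.
  obtain ⟨B, ⟨j⟩⟩ := p.inverseImage.essImage.prop_of_mono w.arrow ⟨A, ⟨i⟩⟩
  obtain ⟨m, hm⟩ := p.inverseImage.map_surjective (j.hom ≫ w.arrow ≫ i.inv)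
  have : Mono (p.inverseImage.map m) := hm ▸ inferInstance
  have : Mono m := p.inverseImage.mono_of_mono_map this
  refine ⟨Subobject.mk m, ?_⟩
  refine (Subobject.mk_eq_of_comm _
    (p.inverseImage.mapIso (Subobject.underlyingIso m) ≪≫ j) ?_)
  have hu : p.inverseImage.map (Subobject.mk m).arrow =
      p.inverseImage.map (Subobject.underlyingIso m).hom ≫ p.inverseImage.map m := by
    rw [← Functor.map_comp, Subobject.underlyingIso_hom_comp_eq_mk]
  rw [hu, hm]
  simp

/-- The counit of a hyperconnected geometric morphism is monic. -/
theorem IsHyperconnected.mono_counit [HasFiniteLimits E] [HasFiniteLimits S]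
    {p : GeomMorphism E S} (hp : p.IsHyperconnected) (X : E) : Mono (p.adj.counit.app X) := by
  have := hp.full
  have := hp.closedUnderSubobjects
  have := p.preservesFiniteLimits_inverseImage
  let A := p.directImage.obj X
  let β : p.inverseImage.obj A ⟶ X := p.adj.counit.app X
  have hmem : p.inverseImage.essImage (p.inverseImage.obj A ⨯ p.inverseImage.obj A) :=
    ⟨A ⨯ A, ⟨PreservesLimitPair.iso p.inverseImage A A⟩⟩
  have : Mono (prod.lift (pullback.fst β β) (pullback.snd β β)) := by
    refine ⟨fun a b h => pullback.hom_ext ?_ ?_⟩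
    · simpa only [Category.assoc, prod.lift_fst] using congrArg (· ≫ prod.fst) h
    · simpa only [Category.assoc, prod.lift_snd] using congrArg (· ≫ prod.snd) h
  -- The kernel pair of the counit embeds in `p^* A ⨯ p^* A ≅ p^* (A ⨯ A)`, so it and both its
  -- projections come from `S`.
  obtain ⟨R, ⟨i⟩⟩ := p.inverseImage.essImage.prop_of_mono
    (prod.lift (pullback.fst β β) (pullback.snd β β)) hmem
  obtain ⟨a, ha⟩ := p.inverseImage.map_surjective (i.hom ≫ pullback.fst β β)
  obtain ⟨b, hb⟩ := p.inverseImage.map_surjective (i.hom ≫ pullback.snd β β)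
  have hab : a = b := by
    -- The transposes of `a` and `b` are the two projections followed by the counit, which agree on
    -- the kernel pair.
    apply (p.adj.homEquiv _ _).symm.injective
    rw [Adjunction.homEquiv_counit, Adjunction.homEquiv_counit, ha, hb, Category.assoc,
      Category.assoc]
    exact congrArg (i.hom ≫ ·) pullback.condition
  have hfs : pullback.fst β β = pullback.snd β β := by
    rw [← cancel_epi i.hom, ← ha, ← hb, hab]
  refine ⟨fun f g h => ?_⟩
  rw [← pullback.lift_fst (f := β) (g := β) f g h, hfs, pullback.lift_snd]

/-! ### Local hyperconnected morphisms: Boolean objects -/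

variable [ElementaryTopos E] [ElementaryTopos S]

/-- For a local hyperconnected geometric morphism, an object with empty direct image is empty. -/
theorem exists_hom_initial_of_directImage {p : GeomMorphism E S} (hl : p.IsLocal)
    (hp : p.IsHyperconnected) {W : E} (f : p.directImage.obj W ⟶ ⊥_ S) :
    Nonempty (W ⟶ ⊥_ E) := by
  obtain ⟨q, ⟨adj⟩, -, -⟩ := hl
  have := hp.closedUnderSubobjects
  have := p.preservesFiniteLimits_inverseImage
  -- Maps `Z ⟶ q 0` correspond to maps `p_* Z ⟶ 0`, of which there is at most one by strictness. So
  -- `q 0` is a subobject of `1 ≅ p^* 1`, hence of the form `p^* B`.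
  have : Mono (terminal.from (q.obj (⊥_ S))) := by
    refine ⟨fun a b _ => (adj.homEquiv _ _).symm.injective ?_⟩
    rw [eq_comp_initial_to ((adj.homEquiv _ _).symm a) ((adj.homEquiv _ _).symm b),
      initial.hom_ext (initial.to (⊥_ S)) (𝟙 _), Category.comp_id]
  obtain ⟨B, ⟨i⟩⟩ := p.inverseImage.essImage.prop_of_mono (terminal.from (q.obj (⊥_ S)))
    ⟨⊤_ S, ⟨PreservesTerminal.iso p.inverseImage⟩⟩
  -- The isomorphism `p^* B ≅ q 0` transposes to `B ⟶ p_* (q 0)`, and the counit leads on to `0`.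
  let g : B ⟶ ⊥_ S :=
    p.adj.homEquiv _ _ i.hom ≫ adj.counit.app (⊥_ S)
  -- The composite `W ⟶ q 0 ≅ p^* B ⟶ p^* 0 ⟶ 0`.
  exact ⟨adj.homEquiv _ _ f ≫ i.inv ≫ p.inverseImage.map g ≫
    (p.adj.homEquiv _ _).symm (initial.to _)⟩

/-- For a local hyperconnected geometric morphism, Boolean objects lie in the image of `p^*`. -/
theorem essImage_of_isBooleanObject {p : GeomMorphism E S} (hl : p.IsLocal)
    (hp : p.IsHyperconnected) {X : E} (hX : IsBooleanObject X) :
    p.inverseImage.essImage X := by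
  have := hp.full
  have := hp.mono_counit X
  obtain ⟨w, hw⟩ := hX.exists_isCompl (Subobject.mk (p.adj.counit.app X))
  have hfac : (⊥ : Subobject X).Factors (p.adj.counit.app (w : E) ≫ w.arrow) := by
    rw [← hw.inf_eq_bot, Subobject.inf_factors]
    refine ⟨?_, Subobject.factors_comp_arrow _⟩
    rw [Subobject.mk_factors_iff]
    -- Naturality of the counit along `w.arrow`.
    exact ⟨p.inverseImage.map (p.directImage.map w.arrow), by simp⟩
  rw [Subobject.bot_eq_initial_to, Subobject.mk_factors_iff] at hfac
  obtain ⟨k, -⟩ := hfac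
  -- Fullness of `p^*` turns `p^* p_* w ⟶ 0 ⟶ p^* 0` into a map `p_* w ⟶ 0`.
  obtain ⟨f⟩ := exists_hom_initial_of_directImage hl hp (W := (w : E))
    (p.inverseImage.preimage (k ≫ initial.to _))
  have htop := hw.sup_eq_top
  rw [subobject_eq_bot w f, sup_bot_eq, ← Subobject.isIso_iff_mk_eq_top] at htop
  exact ⟨_, ⟨asIso (p.adj.counit.app X)⟩⟩

end GeomMorphism

theorem mainTheorem12
    {E : Type u₁} [Category.{v₁} E] [ElementaryTopos E]
    {S : Type u₂} [Category.{v₂} S] [ElementaryTopos S]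
    (hS : IsBooleanTopos S)
    (p : GeomMorphism E S) (hp : p.IsPreCohesive) :
    p.inverseImage.Full ∧ p.inverseImage.Faithful ∧
      p.inverseImage.essImage = (Level.minusInfty E).skeletalBoundaries ∧
      ∀ X : E, (Level.minusInfty E).skeletalBoundaries X ↔ IsBooleanObject X := by
  have h := hp.isHyperconnected
  refine ⟨h.full, h.faithful, ?_, Level.skeletalBoundaries_minusInfty_iff⟩
  ext X
  rw [Level.skeletalBoundaries_minusInfty_iff]
  refine ⟨?_, GeomMorphism.essImage_of_isBooleanObject hp.isLocal h⟩
  rintro ⟨A, ⟨i⟩⟩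
  obtain ⟨e⟩ := h.exists_subobject_orderIso i
  exact (hS A).of_orderIso e
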